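/- Let $R$ be a (not necessarily commutative) ring, let $\mathrm{Mod}(R)$ be the category of all left $R$-modules, and assume that $R$ has finite left global dimension, i.e. that the projective dimensions of all left $R$-modules are bounded by a common integer. For a full subcategory $\mathcal U\subset \mathrm{Mod}(R)$ containing zero and closed under kernels, cokernels and extensions, let $D(\mathcal U)$ and $D(\mathrm{Mod}(R))$ be the unbounded derived categories and let $D_{\mathcal U}(\mathrm{Mod}(R))\subset D(\mathrm{Mod}(R))$ be the full subcategory of those $C$ such that $H^i(C)\in\mathcal U$ for all $i\in\mathbb Z$. 1. If $R$ is left coherent (every finitely generated left ideal is finitely presented) and $\mathrm{mod}(R)$ denotes the full subcategory of finitely presented left $R$-modules, then the functor $$D(\mathrm{mod}(R))\longrightarrow D_{\mathrm{mod}(R)}(\mathrm{Mod}(R))$$ induced by the exact inclusion $\mathrm{mod}(R)\subset\mathrm{Mod}(R)$ is a triangulated functor and an equivalence of categories. 2. In particular, if $R$ is left noetherian and $\mathrm{mod}(R)$ denotes the full subcategory of finitely generated left $R$-modules, then the functor $D(\mathrm{mod}(R))\to D_{\mathrm{mod}(R)}(\mathrm{Mod}(R))$ induced by the inclusion is a triangulated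 functor and an equivalence of categories. -/

import Mathlib

universe u v w w₁ w₂ w₃

/-- A ring `R` is left coherent if every finitely generated left ideal of `R` is finitely
presented as a left `R`-module. -/
class IsLeftCoherent (R : Type u) [Ring R] : Prop where
  finitePresentation_of_fg (I : Submodule R R) (hI : I.FG) : Module.FinitePresentation R I

namespace IsLeftCoherent

variable {R : Type u} [Ring R]

lemma fg_submodule_prod {A B : Type*} [AddCommGroup A] [Module R A] [AddCommGroup B] [Module R B]
    (hA : ∀ N : Submodule R A, N.FG → Module.FinitePresentation R N)
    (hB : ∀ N : Submodule R B, N.FG → Module.FinitePresentation R N)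
    (N : Submodule R (A × B)) (hN : N.FG) : Module.FinitePresentation R N := by
  have : Module.Finite R N := Module.Finite.of_fg hN
  let l : N →ₗ[R] A := LinearMap.fst R A B ∘ₗ N.subtype
  let m : N →ₗ[R] B := LinearMap.snd R A B ∘ₗ N.subtype
  have : Module.FinitePresentation R (LinearMap.range l) :=
    hA _ (Module.Finite.iff_fg.1 inferInstance)
  have hk : (LinearMap.ker l.rangeRestrict).FG :=
    Module.FinitePresentation.fg_ker _ l.surjective_rangeRestrict
  have : Module.Finite R (LinearMap.ker l.rangeRestrict) := Module.Finite.of_fg hk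
  let m' : LinearMap.ker l.rangeRestrict →ₗ[R] B := m ∘ₗ (LinearMap.ker l.rangeRestrict).subtype
  have hm' : Function.Injective m' := by
    intro x y hxy
    have hx : l x.1 = 0 := congrArg Subtype.val x.2
    have hy : l y.1 = 0 := congrArg Subtype.val y.2
    exact Subtype.ext (Subtype.ext (Prod.ext (hx.trans hy.symm) hxy))
  have : Module.FinitePresentation R (LinearMap.range m') :=
    hB _ (Module.Finite.iff_fg.1 inferInstance)
  have : Module.FinitePresentation R (LinearMap.ker l.rangeRestrict) :=
    Module.FinitePresentation.of_equiv (M := LinearMap.range m')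
      (N := LinearMap.ker l.rangeRestrict) (LinearEquiv.ofInjective m' hm').symm
  exact Module.finitePresentation_of_ker _ l.surjective_rangeRestrict

lemma fg_submodule_fin [IsLeftCoherent R] (n : ℕ) (N : Submodule R (Fin n → R)) (hN : N.FG) :
    Module.FinitePresentation R N := by
  induction n with
  | zero => infer_instance
  | succ n ih =>
    let e : (Fin (n + 1) → R) ≃ₗ[R] R × (Fin n → R) := (Fin.consLinearEquiv R fun _ ↦ R).symm
    have := fg_submodule_prod (finitePresentation_of_fg (R := R)) ih (N.map e.toLinearMap)
      (hN.map _)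
    exact .of_equiv (e.submoduleMap N).symm

/-- Over a left coherent ring, finitely generated submodules of finitely presented modules are
finitely presented. -/
lemma fg_submodule [IsLeftCoherent R] {M : Type*} [AddCommGroup M] [Module R M]
    [Module.FinitePresentation R M] (N : Submodule R M) (hN : N.FG) :
    Module.FinitePresentation R N := by
  obtain ⟨n, K, e, hK⟩ := Module.FinitePresentation.exists_fin R M
  let q : (Fin n → R) →ₗ[R] M := e.symm.toLinearMap ∘ₗ K.mkQ
  have hq : Function.Surjective q := e.symm.surjective.comp K.mkQ_surjective
  have hker : LinearMap.ker q = K := by simp [q, LinearMap.ker_comp]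
  have hle : K ≤ N.comap q := by
    rw [← hker]; exact LinearMap.ker_le_comap q
  have hN' : (N.comap q).FG := by
    apply Submodule.fg_of_fg_map_of_fg_inf_ker q
    · rwa [Submodule.map_comap_eq_of_surjective hq]
    · rwa [hker, inf_eq_right.2 hle]
  have := fg_submodule_fin n _ hN'
  let r : N.comap q →ₗ[R] N := q.restrict fun _ hx ↦ hx
  refine Module.finitePresentation_of_surjective r ?_ ?_
  · rintro ⟨y, hy⟩
    obtain ⟨x, rfl⟩ := hq y
    exact ⟨⟨x, hy⟩, rfl⟩
  · have : LinearMap.ker r = K.comap (N.comap q).subtype := by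
      rw [← hker]; ext x; simp [r, Subtype.ext_iff]
    rw [this]
    exact Submodule.fg_of_fg_map_injective _ (N.comap q).injective_subtype
      (by rwa [Submodule.map_comap_subtype, inf_eq_right.2 hle])

lemma finitePresentation_ker [IsLeftCoherent R] {M N : Type*} [AddCommGroup M] [Module R M]
    [AddCommGroup N] [Module R N] [Module.FinitePresentation R M] [Module.FinitePresentation R N]
    (f : M →ₗ[R] N) : Module.FinitePresentation R (LinearMap.ker f) := by
  have := fg_submodule (LinearMap.range f) (Module.Finite.iff_fg.1 inferInstance)
  refine fg_submodule _ ?_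
  rw [← LinearMap.ker_rangeRestrict]
  exact Module.FinitePresentation.fg_ker _ f.surjective_rangeRestrict

end IsLeftCoherent

/-- Left noetherian rings are left coherent. -/
instance (R : Type u) [Ring R] [IsNoetherianRing R] : IsLeftCoherent R where
  finitePresentation_of_fg _ _ := Module.finitePresentation_of_finite _ _


noncomputable section

open CategoryTheory Limits Pretriangulated ZeroObject

namespace CategoryTheory.ObjectProperty

variable {A : Type u} [Category.{v} A] [Abelian A]

/-- A non-empty class of objects of an abelian category, closed under kernels, cokernels and
extensions (the full subcategory is then abelian, and its inclusion is exact). Closure under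
kernels makes non-emptiness equivalent to containing a zero object. -/
class IsWeakSerre (P : ObjectProperty A) : Prop extends P.ContainsZero,
    P.IsClosedUnderKernels, P.IsClosedUnderCokernels, P.IsClosedUnderExtensions

/-- The objects of the derived category `D(A)` all of whose cohomology objects satisfy `P`. The
full subcategory on these objects is `D_P(A)`. -/
def cohomologyIn [HasDerivedCategory.{w} A] (P : ObjectProperty A) : ObjectProperty (DerivedCategory A) :=
  fun X ↦ ∀ n : ℤ, P ((DerivedCategory.homologyFunctor A n).obj X)

variable (P : ObjectProperty A) [P.IsWeakSerre]

instance : P.IsClosedUnderIsomorphisms where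
  of_iso {X Y} e hX := by
    obtain ⟨Z, hZ, hPZ⟩ := P.exists_prop_of_containsZero
    exact P.prop_of_isLimit_kernelFork (f := (0 : X ⟶ Z))
      (k := KernelFork.ofι e.inv (by simp))
      (IsLimit.ofIsoLimit (KernelFork.IsLimit.ofId (0 : X ⟶ Z) rfl)
        (Fork.ext e (by simp))) hX hPZ

instance : P.IsClosedUnderBinaryProducts where
  limitsOfShape_le := by
    rintro X ⟨p⟩
    refine P.prop_of_iso ?_ (P.prop_biprod (p.prop_diag_obj (.mk .left))
      (p.prop_diag_obj (.mk .right)))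
    exact biprod.isoProd _ _ ≪≫ IsLimit.conePointUniqueUpToIso (prodIsProd _ _)
      ((IsLimit.postcomposeHomEquiv (diagramIsoPair p.diag) _).2 p.isLimit)

instance : P.IsClosedUnderFiniteProducts := .mk'

instance : PreservesFiniteLimits P.ι :=
  have := P.preservesKernels_ι
  P.ι.preservesFiniteLimits_of_preservesKernels

instance : PreservesFiniteColimits P.ι :=
  have := P.preservesCokernels_ι
  P.ι.preservesFiniteColimits_of_preservesCokernels

/-- In an exact sequence `X₁ ⟶ X₂ ⟶ X₃ ⟶ X₄ ⟶ X₅`, the middle object satisfies `P` when the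
four others do. -/
lemma prop_of_exact₅ {X₁ X₂ X₃ X₄ X₅ : A} {f : X₁ ⟶ X₂} {g : X₂ ⟶ X₃} {h : X₃ ⟶ X₄} {k : X₄ ⟶ X₅}
    (wfg : f ≫ g = 0) (wgh : g ≫ h = 0) (whk : h ≫ k = 0)
    (e₂ : (ShortComplex.mk f g wfg).Exact) (e₃ : (ShortComplex.mk g h wgh).Exact)
    (e₄ : (ShortComplex.mk h k whk).Exact)
    (h₁ : P X₁) (h₂ : P X₂) (h₄ : P X₄) (h₅ : P X₅) : P X₃ := by
  have w₂ : f ≫ factorThruImage g = 0 := by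
    rw [← cancel_mono (image.ι g), Category.assoc, image.fac, wfg, zero_comp]
  have w₄ : image.ι h ≫ k = 0 := by
    rw [← cancel_epi (factorThruImage h), image.fac_assoc, whk, comp_zero]
  have w₃ : image.ι g ≫ factorThruImage h = 0 := by
    rw [← cancel_mono (image.ι h), ← cancel_epi (factorThruImage g)]
    simp [wgh]
  have e₂' : (ShortComplex.mk f (factorThruImage g) w₂).Exact :=
    (ShortComplex.exact_iff_of_epi_of_isIso_of_mono
      (S₁ := ShortComplex.mk f (factorThruImage g) w₂) (S₂ := ShortComplex.mk f g wfg)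
      { τ₁ := 𝟙 _, τ₂ := 𝟙 _, τ₃ := image.ι g }).2 e₂
  have e₄' : (ShortComplex.mk (image.ι h) k w₄).Exact :=
    (ShortComplex.exact_iff_of_epi_of_isIso_of_mono
      (S₁ := ShortComplex.mk h k whk) (S₂ := ShortComplex.mk (image.ι h) k w₄)
      { τ₁ := factorThruImage h, τ₂ := 𝟙 _, τ₃ := 𝟙 _ }).1 e₄
  have e₃' : (ShortComplex.mk (image.ι g) (factorThruImage h) w₃).Exact :=
    (ShortComplex.exact_iff_of_epi_of_isIso_of_mono
      (S₁ := ShortComplex.mk g (factorThruImage h)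
        (by rw [← cancel_mono (image.ι h)]; simp [wgh]))
      (S₂ := ShortComplex.mk (image.ι g) (factorThruImage h) w₃)
      { τ₁ := factorThruImage g, τ₂ := 𝟙 _, τ₃ := 𝟙 _ }).1
    ((ShortComplex.exact_iff_of_epi_of_isIso_of_mono
      (S₁ := ShortComplex.mk g (factorThruImage h)
        (by rw [← cancel_mono (image.ι h)]; simp [wgh]))
      (S₂ := ShortComplex.mk g h wgh)
      { τ₁ := 𝟙 _, τ₂ := 𝟙 _, τ₃ := image.ι h }).2 e₃)
  have p₁ : P (image g) := P.prop_of_isColimit_cokernelCofork e₂'.gIsCokernel h₁ h₂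
  have p₃ : P (image h) := P.prop_of_isLimit_kernelFork e₄'.fIsKernel h₄ h₅
  exact P.prop_X₂_of_shortExact
    (S := ShortComplex.mk (image.ι g) (factorThruImage h) w₃) ⟨e₃'⟩ p₁ p₃

section

variable [HasDerivedCategory.{w} A]

instance : P.cohomologyIn.IsClosedUnderIsomorphisms where
  of_iso e hX n := P.prop_of_iso ((DerivedCategory.homologyFunctor A n).mapIso e) (hX n)

instance : P.cohomologyIn.IsTriangulated where
  exists_zero := ⟨_, isZero_zero (DerivedCategory A), fun n ↦
    P.prop_of_isZero ((DerivedCategory.homologyFunctor A n).map_isZero (isZero_zero _))⟩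
  toIsStableUnderShift := ⟨fun a ↦ ⟨fun X hX n ↦
    P.prop_of_iso (((DerivedCategory.homologyFunctor A 0).shiftIso a n (a + n) rfl).app X).symm
      (hX (a + n))⟩⟩
  toIsTriangulatedClosed₂ := .mk' fun T hT h₁ h₃ n ↦
    P.prop_of_exact₅ _ _ _
      (DerivedCategory.HomologySequence.exact₁ T hT (n - 1) n (by lia))
      (DerivedCategory.HomologySequence.exact₂ T hT n)
      (DerivedCategory.HomologySequence.exact₃ T hT n (n + 1) rfl)
      (h₃ _) (h₁ _) (h₃ _) (h₁ _)

end

variable [HasDerivedCategory.{w₁} P.FullSubcategory] [HasDerivedCategory.{w₂} A]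

/-- The functor `D(P) ⥤ D(A)` induced by the (exact) inclusion of the full subcategory `P` takes
its values in `D_P(A)`. -/
lemma cohomologyIn_mapDerivedCategory_obj (X : DerivedCategory P.FullSubcategory) :
    P.cohomologyIn (P.ι.mapDerivedCategory.obj X) := by
  intro n
  let K := DerivedCategory.Q.objPreimage X
  refine P.prop_of_iso ?_ ((K.sc n).homology).property
  exact ((K.sc n).mapHomologyIso P.ι).symm ≪≫
    ((DerivedCategory.homologyFunctorFactors A n).app
      ((P.ι.mapHomologicalComplex (ComplexShape.up ℤ)).obj K)).symm ≪≫
    (DerivedCategory.homologyFunctor A n).mapIso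
      ((P.ι.mapDerivedCategoryFactors.app K).symm ≪≫
        P.ι.mapDerivedCategory.mapIso (DerivedCategory.Q.objObjPreimageIso X))

/-- The obvious (triangulated) functor `D(P) ⥤ D_P(A)` induced by the inclusion of the full
subcategory `P` of `A`. -/
def derivedInclusion : DerivedCategory P.FullSubcategory ⥤ P.cohomologyIn.FullSubcategory :=
  P.cohomologyIn.lift P.ι.mapDerivedCategory P.cohomologyIn_mapDerivedCategory_obj

instance : P.derivedInclusion.CommShift ℤ :=
  inferInstanceAs (Functor.CommShift (P.cohomologyIn.lift P.ι.mapDerivedCategory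
    P.cohomologyIn_mapDerivedCategory_obj) ℤ)

instance : P.derivedInclusion.IsTriangulated :=
  inferInstanceAs (Functor.IsTriangulated (P.cohomologyIn.lift P.ι.mapDerivedCategory
    P.cohomologyIn_mapDerivedCategory_obj))

end CategoryTheory.ObjectProperty

namespace ModuleCat

variable (R : Type u) [Ring R]

/-- The finitely presented left `R`-modules. -/
def isFinitelyPresented : ObjectProperty (ModuleCat.{v} R) :=
  fun M ↦ Module.FinitePresentation R M

instance [IsLeftCoherent R] : (isFinitelyPresented.{u, v} R).IsWeakSerre where
  exists_zero := ⟨ModuleCat.of R PUnit, ModuleCat.isZero_of_subsingleton _,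
    inferInstanceAs (Module.FinitePresentation R PUnit.{v + 1})⟩
  kernels_le := by
    rintro _ @⟨X, Y, f, k, hk, hX, hY⟩
    have : Module.FinitePresentation R X := hX
    have : Module.FinitePresentation R Y := hY
    have := IsLeftCoherent.finitePresentation_ker f.hom
    let e : ModuleCat.of R (LinearMap.ker f.hom) ≅ k.pt :=
      IsLimit.conePointUniqueUpToIso (ModuleCat.kernelIsLimit f) hk
    exact Module.FinitePresentation.of_equiv (M := LinearMap.ker f.hom) e.toLinearEquiv
  cokernels_le := by
    rintro _ @⟨X, Y, f, k, hk, hX, hY⟩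
    have : Module.FinitePresentation R X := hX
    have : Module.FinitePresentation R Y := hY
    have : Module.FinitePresentation R (Y ⧸ LinearMap.range f.hom) :=
      Module.finitePresentation_of_surjective _ (Submodule.mkQ_surjective _)
        (by rw [Submodule.ker_mkQ]; exact Module.Finite.iff_fg.1 inferInstance)
    let e : ModuleCat.of R (Y ⧸ LinearMap.range f.hom) ≅ k.pt :=
      IsColimit.coconePointUniqueUpToIso (ModuleCat.cokernelIsColimit f) hk
    exact Module.FinitePresentation.of_equiv (M := Y ⧸ LinearMap.range f.hom) e.toLinearEquiv
  prop_X₂_of_shortExact {S} hS h₁ h₃ := by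
    have : Module.FinitePresentation R S.X₁ := h₁
    have : Module.FinitePresentation R S.X₃ := h₃
    have e : LinearMap.range S.f.hom = LinearMap.ker S.g.hom := hS.exact.moduleCat_range_eq_ker
    have : Module.FinitePresentation R (LinearMap.ker S.g.hom) := by
      rw [← e]
      exact .of_equiv (LinearEquiv.ofInjective S.f.hom hS.moduleCat_injective_f)
    exact Module.finitePresentation_of_ker S.g.hom hS.moduleCat_surjective_g

/-- Over a left noetherian ring, a module is finitely generated iff it is finitely presented. -/
lemma isFG_eq_isFinitelyPresented [IsNoetherianRing R] :
    isFG.{v} R = isFinitelyPresented.{u, v} R := by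
  ext M
  exact (Module.finitePresentation_iff_finite R M).symm

instance [IsNoetherianRing R] : (isFG.{v} R).IsWeakSerre := by
  rw [isFG_eq_isFinitelyPresented]
  infer_instance

/-- The left global dimension of `R`: the supremum of the projective dimensions of all left
`R`-modules (`⊥` for the zero ring, `⊤` if it is infinite). -/
def leftGlobalDimension : WithBot ℕ∞ :=
  ⨆ M : ModuleCat.{u} R, projectiveDimension M

end ModuleCat

end

/-! The key point is that every `X` in `D_P(A)` is represented by a K-projective complex with terms
in `P` (`hasKProjectiveModel_of_cohomologyIn`). Cover each `H^n(X)` by a projective in `P` and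
assemble these into a complex `Y` with zero differential, which is K-projective without any
boundedness. The covers are induced by a map `Y ⟶ X`, and the cohomology of its cone consists of the
kernels of the covers, so its projective dimension has dropped. Induction on a uniform bound ends
when the cohomology is projective and `X ≅ Y`. Essential surjectivity is then immediate. Morphisms
out of such a model are homotopy classes in both derived categories, and `K(P) ⥤ K(A)` is fully
faithful, hence so is `D(P) ⥤ D(A)`. For modules the covers are finite free. -/

open CategoryTheory Limits Pretriangulated ZeroObject

/-! ### Complexes of projectives with zero differential -/

namespace CochainComplex

variable {A : Type u} [Category.{v} A] [Abelian A]

/-- A cochain complex of projective objects with zero differentials is K-projective. -/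
lemma isKProjective_of_d_eq_zero (F : CochainComplex A ℤ) [∀ n, Projective (F.X n)]
    (hF : ∀ i j, F.d i j = 0) : F.IsKProjective where
  nonempty_homotopy_zero {L} f hL := by
    -- As `F` has zero differential, `f` lands in cycles, which are boundaries in `L`. The other
    -- half of the homotopy equation vanishes, so no compatibility between degrees is needed.
    have lift (i j : ℤ) (hij : j + 1 = i) : ∃ h : F.X i ⟶ L.X j, h ≫ L.d j i = f.f i := by
      have hf : f.f i ≫ L.d i (i + 1) = 0 := by rw [f.comm, hF, zero_comp]
      have hex := (L.exactAt_iff' j i (i + 1) (by simp [← hij]) (by simp)).1 (hL i)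
      exact ⟨hex.liftFromProjective (P := F.X i) (f.f i) hf, hex.liftFromProjective_comp _ _⟩
    choose h hh using lift
    exact ⟨{
      hom i j := if hij : j + 1 = i then h i j hij else 0
      zero i j hij := dif_neg hij
      comm i := by
        rw [dNext_eq _ (show (ComplexShape.up ℤ).Rel i (i + 1) from rfl),
          prevD_eq _ (show (ComplexShape.up ℤ).Rel (i - 1) i by simp)]
        simp [hF, hh] }⟩

/-- The cohomology of a complex with zero differentials. -/
noncomputable def XIsoHomologyOfDEqZero (F : CochainComplex A ℤ) (hF : ∀ i j, F.d i j = 0) (n : ℤ) :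
    F.X n ≅ F.homology n :=
  have := F.isIso_iCycles n _ rfl (hF _ _)
  have := F.isIso_homologyπ _ n rfl (hF _ _)
  (asIso (F.iCycles n)).symm ≪≫ asIso (F.homologyπ n)

/-- Given a complex `F` of projective objects with zero differentials, any family of
morphisms `F.X n ⟶ K.homology n` is induced by a morphism of complexes. -/
lemma exists_hom_of_d_eq_zero (F K : CochainComplex A ℤ) [∀ n, Projective (F.X n)]
    (hF : ∀ i j, F.d i j = 0) (π : ∀ n, F.X n ⟶ K.homology n) :
    ∃ f : F ⟶ K, ∀ n,
      (F.XIsoHomologyOfDEqZero hF n).hom ≫ HomologicalComplex.homologyMap f n = π n := by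
  let f : F ⟶ K :=
    { f n := Projective.factorThru (π n) (K.homologyπ n) ≫ K.iCycles n
      comm' i j _ := by simp [hF] }
  refine ⟨f, fun n ↦ ?_⟩
  have := F.isIso_iCycles n _ rfl (hF _ _)
  have hc : inv (F.iCycles n) ≫ HomologicalComplex.cyclesMap f n =
      Projective.factorThru (π n) (K.homologyπ n) := by
    rw [← cancel_mono (K.iCycles n)]
    simp [f]
  simp [XIsoHomologyOfDEqZero, reassoc_of% hc]

section

open DerivedCategory

variable [HasDerivedCategory.{w₂} A]

/-- The cohomology of a complex, computed in the derived category. -/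
noncomputable def homologyQIso (K : CochainComplex A ℤ) (n : ℤ) :
    (homologyFunctor A n).obj (Q.obj K) ≅ K.homology n :=
  (homologyFunctorFactors A n).app K

lemma homologyQIso_inv_naturality {K L : CochainComplex A ℤ} (f : K ⟶ L) (n : ℤ) :
    (K.homologyQIso n).inv ≫ (homologyFunctor A n).map (Q.map f) =
      HomologicalComplex.homologyMap f n ≫ (L.homologyQIso n).inv :=
  ((homologyFunctorFactors A n).inv.naturality f).symm

lemma exists_Q_map_of_d_eq_zero (F : CochainComplex A ℤ)
    [∀ n, Projective (F.X n)] (hF : ∀ i j, F.d i j = 0) {K : CochainComplex A ℤ}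
    {X : DerivedCategory A} (e : Q.obj K ≅ X) (π : ∀ n, F.X n ⟶ (homologyFunctor A n).obj X) :
    ∃ f : F ⟶ K, ∀ n, (F.XIsoHomologyOfDEqZero hF n ≪≫ (F.homologyQIso n).symm).hom ≫
      (homologyFunctor A n).map (Q.map f ≫ e.hom) = π n := by
  obtain ⟨f, hf⟩ := F.exists_hom_of_d_eq_zero K hF
    (fun n ↦ π n ≫ (homologyFunctor A n).map e.inv ≫ (K.homologyQIso n).hom)
  refine ⟨f, fun n ↦ ?_⟩
  simp [reassoc_of% homologyQIso_inv_naturality f n, reassoc_of% hf n]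

end

end CochainComplex

/-! ### K-projective models with terms in `P` -/

namespace CategoryTheory.ObjectProperty

open _root_.DerivedCategory

variable {A : Type u} [Category.{v} A] [Abelian A] (P : ObjectProperty A) [P.IsWeakSerre]

/-- The functor induced by the inclusion of `P` on the homotopy categories. -/
abbrev homotopyInclusion :
    HomotopyCategory P.FullSubcategory (.up ℤ) ⥤ HomotopyCategory A (.up ℤ) :=
  P.ι.mapHomotopyCategory (.up ℤ)

/-- The complexes with terms in `P` that are K-projective as complexes in the ambient category. -/
def kProjective : ObjectProperty (HomotopyCategory P.FullSubcategory (.up ℤ)) :=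
  (HomotopyCategory.subcategoryAcyclic A).leftOrthogonal.inverseImage P.homotopyInclusion

instance : P.kProjective.IsTriangulated := by
  unfold kProjective
  infer_instance

instance : P.kProjective.IsClosedUnderIsomorphisms := by
  unfold kProjective
  infer_instance

lemma homotopyInclusion_obj_acyclic {Y : HomotopyCategory P.FullSubcategory (.up ℤ)}
    (hY : HomotopyCategory.subcategoryAcyclic _ Y) :
    HomotopyCategory.subcategoryAcyclic A (P.homotopyInclusion.obj Y) := by
  obtain ⟨Y, rfl⟩ := HomotopyCategory.quotient_obj_surjective Y
  rw [HomotopyCategory.quotient_obj_mem_subcategoryAcyclic_iff_exactAt] at hY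
  refine (HomotopyCategory.quotient_obj_mem_subcategoryAcyclic_iff_exactAt
    ((P.ι.mapHomologicalComplex _).obj Y)).2 fun n ↦ ?_
  exact (hY n).map P.ι

/-- The inclusion of homotopy categories is faithful and preserves acyclic complexes. -/
lemma kProjective.leftOrthogonal {L : HomotopyCategory P.FullSubcategory (.up ℤ)}
    (hL : P.kProjective L) : (HomotopyCategory.subcategoryAcyclic _).leftOrthogonal L :=
  fun _ f hY ↦ P.homotopyInclusion.map_injective
    (by rw [hL (P.homotopyInclusion.map f) (P.homotopyInclusion_obj_acyclic hY), Functor.map_zero])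

variable [HasDerivedCategory.{w₂} A]

/-- The objects of the derived category that are represented by a K-projective complex with
terms in `P`. -/
def hasKProjectiveModel : ObjectProperty (DerivedCategory A) :=
  fun X ↦ ∃ L, P.kProjective L ∧ Nonempty (Qh.obj (P.homotopyInclusion.obj L) ≅ X)

variable {P}

-- Localising at acyclic complexes does not change morphisms out of a K-projective complex, and
-- `homotopyInclusion` is fully faithful.
omit [P.IsWeakSerre] in
lemma kProjective.map_bijective {L : HomotopyCategory P.FullSubcategory (.up ℤ)}
    (hL : P.kProjective L) (Y : HomotopyCategory P.FullSubcategory (.up ℤ)) :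
    Function.Bijective ((P.homotopyInclusion ⋙ Qh).map : (L ⟶ Y) → _) :=
  (leftOrthogonal.map_bijective_of_isTriangulated hL Qh (P.homotopyInclusion.obj Y)).comp
    ⟨P.homotopyInclusion.map_injective, P.homotopyInclusion.map_surjective⟩

/-- The connecting morphism lifts to a morphism of models in `K(P)`; completing it to a triangle
there gives a model of the middle term. -/
lemma hasKProjectiveModel_obj₂ {T : Triangle (DerivedCategory A)} (hT : T ∈ distTriang _)
    (h₁ : P.hasKProjectiveModel T.obj₁) (h₃ : P.hasKProjectiveModel T.obj₃) :
    P.hasKProjectiveModel T.obj₂ := by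
  obtain ⟨L₁, hL₁, ⟨e₁⟩⟩ := h₁
  obtain ⟨L₃, hL₃, ⟨e₃⟩⟩ := h₃
  let G := P.homotopyInclusion ⋙ Qh
  obtain ⟨h, hh⟩ := (hL₃.map_bijective (L₁⟦(1 : ℤ)⟧)).surjective
    (e₃.hom ≫ T.mor₃ ≫ e₁.inv⟦(1 : ℤ)⟧' ≫ (G.commShiftIso (1 : ℤ)).inv.app L₁)
  obtain ⟨L₂, f, g, hD⟩ := distinguished_cocone_triangle₂ h
  have hGD := G.map_distinguished _ hD
  have comm : (G.mapTriangle.obj (Triangle.mk f g h)).mor₃ ≫ e₁.hom⟦(1 : ℤ)⟧' =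
      e₃.hom ≫ T.mor₃ := by
    have hh' : G.map h ≫ (G.commShiftIso (1 : ℤ)).hom.app L₁ =
        e₃.hom ≫ T.mor₃ ≫ e₁.inv⟦(1 : ℤ)⟧' := by
      refine (Iso.eq_comp_inv ((G.commShiftIso (1 : ℤ)).app L₁)).1 ?_
      rw [Category.assoc, Category.assoc]
      exact hh
    refine (Iso.eq_comp_inv ((shiftFunctor _ (1 : ℤ)).mapIso e₁)).1 
      (hh'.trans (Category.assoc _ _ _).symm)
  obtain ⟨b, hb₁, hb₂⟩ := complete_distinguished_triangle_morphism₂ _ T hGD hT e₁.hom e₃.hom comm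
  let φ : G.mapTriangle.obj (Triangle.mk f g h) ⟶ T :=
    { hom₁ := e₁.hom, hom₂ := b, hom₃ := e₃.hom, comm₁ := hb₁, comm₂ := hb₂, comm₃ := comm }
  have hb : IsIso b := isIso₂_of_isIso₁₃ φ hGD hT (inferInstanceAs (IsIso e₁.hom))
    (inferInstanceAs (IsIso e₃.hom))
  exact ⟨L₂, P.kProjective.ext_of_isTriangulatedClosed₂ _ hD hL₁ hL₃, ⟨@asIso _ _ _ _ b hb⟩⟩

-- `Y` is the complex with terms `F n` and zero differential; projectivity of `F n` lifts `π n` to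
-- cycles of a complex representing `X`.
variable (P) in
omit [P.IsWeakSerre] in
lemma exists_hom_from_kProjective (X : DerivedCategory A) (F : ℤ → A) (hF : ∀ n, P (F n))
    [∀ n, Projective (F n)] (π : ∀ n, F n ⟶ (homologyFunctor A n).obj X) :
    ∃ (Y : DerivedCategory A) (f : Y ⟶ X) (e : ∀ n, F n ≅ (homologyFunctor A n).obj Y),
      P.hasKProjectiveModel Y ∧ ∀ n, (e n).hom ≫ (homologyFunctor A n).map f = π n := by
  let K := Q.objPreimage X
  let eX : Q.obj K ≅ X := Q.objObjPreimageIso X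
  let L : CochainComplex P.FullSubcategory ℤ := { X n := ⟨F n, hF n⟩, d _ _ := 0 }
  let L' : CochainComplex A ℤ := (P.ι.mapHomologicalComplex _).obj L
  have hL' (i j : ℤ) : L'.d i j = 0 := P.ι.map_zero _ _
  have (n : ℤ) : Projective (L'.X n) := inferInstanceAs (Projective (F n))
  have := CochainComplex.isKProjective_of_d_eq_zero L' hL'
  obtain ⟨f, hf⟩ := L'.exists_Q_map_of_d_eq_zero hL' eX π
  exact ⟨Q.obj L', Q.map f ≫ eX.hom, fun n ↦ L'.XIsoHomologyOfDEqZero hL' n ≪≫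
    (L'.homologyQIso n).symm, ⟨(HomotopyCategory.quotient _ _).obj L,
      CochainComplex.IsKProjective.leftOrthogonal L', ⟨(quotientCompQhIso A).app L'⟩⟩, hf⟩

/-- If `P` has enough objects that are projective in the ambient category, every object of the
derived category whose cohomology is in `P` and of bounded projective dimension is represented
by a K-projective complex with terms in `P`. -/
lemma hasKProjectiveModel_of_cohomologyIn
    (enough : ∀ M, P M → ∃ (F : A) (π : F ⟶ M), P F ∧ Projective F ∧ Epi π)
    (d : ℕ) (X : DerivedCategory A) (hX : P.cohomologyIn X)
    (hd : ∀ n, HasProjectiveDimensionLT ((homologyFunctor A n).obj X) (d + 1)) :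
    P.hasKProjectiveModel X := by
  induction d generalizing X with
  | zero =>
    have (n : ℤ) : Projective ((homologyFunctor A n).obj X) :=
      projective_iff_hasProjectiveDimensionLT_one.2 (hd n)
    obtain ⟨Y, f, e, ⟨L, hL, ⟨eL⟩⟩, he⟩ :=
      P.exists_hom_from_kProjective X (fun n ↦ (homologyFunctor A n).obj X) hX (fun n ↦ 𝟙 _)
    have : IsIso f := (isIso_iff A f).2 fun n ↦ by
      rw [← (Iso.inv_comp_eq (e n)).2 (he n).symm]
      infer_instance
    exact ⟨L, hL, ⟨eL ≪≫ asIso f⟩⟩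
  | succ d ih =>
    choose F π hF _ _ using fun n ↦ enough _ (hX n)
    obtain ⟨Y, f, e, hY, he⟩ := P.exists_hom_from_kProjective X F hF π
    obtain ⟨Z, g, h, hT⟩ := distinguished_cocone_triangle f
    let T := Triangle.mk f g h
    have hepi (n : ℤ) : Epi ((homologyFunctor A n).map f) := by
      rw [← (Iso.inv_comp_eq (e n)).2 (he n).symm]
      infer_instance
    -- Surjectivity of `H(f)` splits the long exact sequence into `0 ⟶ H^n(Z) ⟶ H^(n+1)(Y) ⟶
    -- H^(n+1)(X) ⟶ 0`.
    have hmono (n : ℤ) : Mono (HomologySequence.δ T n (n + 1)) :=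
      (HomologySequence.exact₃ T hT n (n + 1)).mono_g
        ((HomologySequence.epi_homologyMap_mor₁_iff T hT n).1 (hepi n))
    have hS (n : ℤ) : (ShortComplex.mk _ _ (HomologySequence.δ_comp T hT n (n + 1))).ShortExact :=
      { exact := HomologySequence.exact₁ T hT n (n + 1), mono_f := hmono n, epi_g := hepi (n + 1) }
    have hFY (n : ℤ) : Projective ((homologyFunctor A n).obj Y) := .of_iso (e n) inferInstance
    refine hasKProjectiveModel_obj₂ hT hY (ih Z (fun n ↦ ?_) fun n ↦ ?_)
    · exact P.prop_of_isLimit_kernelFork (hS n).fIsKernel (P.prop_of_iso (e _) (hF _)) (hX _)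
    · exact (hS n).hasProjectiveDimensionLT_X₁ (d + 1)
        (inferInstanceAs (HasProjectiveDimensionLT ((homologyFunctor A (n + 1)).obj Y) (d + 1)))
        (hd (n + 1))

/-! ### Comparison of `D(P)` with `D_P(A)` -/

section

variable [HasDerivedCategory.{w₁} P.FullSubcategory]

/-- The exact, fully faithful inclusion of `P` reflects quasi-isomorphisms. -/
lemma isIso_Qh_map_of_homotopyInclusion {X Y : HomotopyCategory P.FullSubcategory (.up ℤ)}
    (f : X ⟶ Y) (hf : IsIso (Qh.map (P.homotopyInclusion.map f))) : IsIso (Qh.map f) := by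
  rw [isIso_Qh_map_iff] at hf ⊢
  obtain ⟨X, rfl⟩ := HomotopyCategory.quotient_obj_surjective X
  obtain ⟨Y, rfl⟩ := HomotopyCategory.quotient_obj_surjective Y
  obtain ⟨f, rfl⟩ := (HomotopyCategory.quotient _ _).map_surjective f
  replace hf := (HomotopyCategory.quotient_map_mem_quasiIso_iff
    ((P.ι.mapHomologicalComplex _).map f)).1 hf
  rw [HomotopyCategory.quotient_map_mem_quasiIso_iff]
  exact (HomologicalComplex.quasiIso_map_iff_of_preservesHomology f P.ι).1 hf

/-- A model of the image of `X` in `D(A)` works: K-projectivity lifts the isomorphism to a morphism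
in `K(P)`, which is a quasi-isomorphism already there. -/
lemma exists_kProjective_iso (h : P.cohomologyIn ≤ P.hasKProjectiveModel)
    (X : DerivedCategory P.FullSubcategory) :
    ∃ L, P.kProjective L ∧ Nonempty (Qh.obj L ≅ X) := by
  obtain ⟨L, hL, ⟨e⟩⟩ := h _ (P.cohomologyIn_mapDerivedCategory_obj X)
  let Y := Qh.objPreimage X
  let eY : Qh.obj (P.homotopyInclusion.obj Y) ≅ P.ι.mapDerivedCategory.obj X :=
    (P.ι.mapDerivedCategoryFactorsh.app Y).symm ≪≫
      P.ι.mapDerivedCategory.mapIso (Qh.objObjPreimageIso X)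
  obtain ⟨f, hf⟩ := (hL.map_bijective Y).surjective (e ≪≫ eY.symm).hom
  have hQ : IsIso (Qh.map (P.homotopyInclusion.map f)) := by
    change IsIso ((P.homotopyInclusion ⋙ Qh).map f)
    rw [hf]
    infer_instance
  have := isIso_Qh_map_of_homotopyInclusion f hQ
  exact ⟨L, hL, ⟨asIso (Qh.map f) ≪≫ Qh.objObjPreimageIso X⟩⟩

lemma mapDerivedCategory_map_bijective (h : P.cohomologyIn ≤ P.hasKProjectiveModel)
    (X Y : DerivedCategory P.FullSubcategory) :
    Function.Bijective (P.ι.mapDerivedCategory.map : (X ⟶ Y) → _) := by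
  obtain ⟨L, hL, ⟨eX⟩⟩ := exists_kProjective_iso h X
  let eY := Qh.objObjPreimageIso Y
  let Z := Qh.objPreimage Y
  let φ := P.ι.mapDerivedCategoryFactorsh
  have hLZ : Function.Bijective
      (P.ι.mapDerivedCategory.map : (Qh.obj L ⟶ Qh.obj Z) → _) := by
    -- Morphisms from `L` in `D(P)` and in `D(A)` are both those in `K(P)`.
    rw [← Function.Bijective.of_comp_iff _
        (leftOrthogonal.map_bijective_of_isTriangulated (kProjective.leftOrthogonal P hL) Qh Z),
      ← Function.Bijective.of_comp_iff' (Iso.homCongr (φ.app L) (φ.app Z)).bijective]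
    convert hL.map_bijective Z using 1
    ext f
    refine (Iso.inv_comp_eq _).2 ?_
    exact φ.hom.naturality f
  let D := P.ι.mapDerivedCategory
  rw [← Function.Bijective.of_comp_iff _ (Iso.homCongr eX eY).bijective,
    ← Function.Bijective.of_comp_iff' (Iso.homCongr (D.mapIso eX) (D.mapIso eY)).symm.bijective]
  convert hLZ using 1
  ext f
  simp [D, ← Functor.map_comp]

/-- If `P` has enough objects that are projective in the ambient category and the objects of `P`
have bounded projective dimension, then `D(P) ⥤ D_P(A)` is an equivalence. -/
theorem derivedInclusion_isEquivalence
    (enough : ∀ M, P M → ∃ (F : A) (π : F ⟶ M), P F ∧ Projective F ∧ Epi π)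
    (d : ℕ) (hd : ∀ M, P M → HasProjectiveDimensionLT M d) :
    P.derivedInclusion.IsEquivalence := by
  have h : P.cohomologyIn ≤ P.hasKProjectiveModel := fun X hX ↦
    -- The induction starts from projective cohomology, that is from the bound `1`, so `d` is
    -- weakened to `d + 1`.
    hasKProjectiveModel_of_cohomologyIn enough d X hX fun n ↦
      have := hd _ (hX n)
      hasProjectiveDimensionLT_of_ge _ d _ (Nat.le_succ d)
  have : P.ι.mapDerivedCategory.Faithful :=
    ⟨fun {X Y} _ _ hfg ↦ (mapDerivedCategory_map_bijective h X Y).injective hfg⟩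
  have : P.ι.mapDerivedCategory.Full :=
    ⟨fun {X Y} ↦ (mapDerivedCategory_map_bijective h X Y).surjective⟩
  have : P.derivedInclusion.Faithful := by
    unfold derivedInclusion
    infer_instance
  have : P.derivedInclusion.Full := by
    unfold derivedInclusion
    infer_instance
  have : P.derivedInclusion.EssSurj := ⟨fun X ↦ by
    obtain ⟨L, -, ⟨e⟩⟩ := h _ X.property
    exact ⟨Qh.obj L, ⟨P.cohomologyIn.ι.preimageIso
      (P.ι.mapDerivedCategoryFactorsh.app L ≪≫ e)⟩⟩⟩
  exact { }

end

end CategoryTheory.ObjectProperty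

/-! ### Modules over rings of finite global dimension -/

namespace ModuleCat

variable (R : Type u) [Ring R]

lemma exists_hasProjectiveDimensionLT (hR : leftGlobalDimension R ≠ ⊤) :
    ∃ d : ℕ, ∀ M : ModuleCat.{u} R, HasProjectiveDimensionLT M d := by
  obtain ⟨d, hd⟩ : ∃ d : ℕ, leftGlobalDimension R < d := by
    generalize leftGlobalDimension R = x at hR
    induction x with
    -- The value `⊥` means that all modules vanish, which is what dimension `< 0` says.
    | bot => exact ⟨0, WithBot.bot_lt_coe _⟩
    | coe x =>
      induction x with
      | top => exact (hR rfl).elim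
      | coe n => exact ⟨n + 1, by exact_mod_cast Nat.lt_succ_self n⟩
  exact ⟨d, fun M ↦ projectiveDimension_lt_iff.1
    ((le_iSup (fun M : ModuleCat.{u} R ↦ projectiveDimension M) M).trans_lt hd)⟩

variable {R}

/-- Any finitely generated module is a quotient of a finitely presented projective module. -/
lemma exists_epi_of_finite (M : ModuleCat.{u} R) [Module.Finite R M] :
    ∃ (F : ModuleCat.{u} R) (π : F ⟶ M),
      isFinitelyPresented.{u, u} R F ∧ Projective F ∧ Epi π := by
  obtain ⟨n, f, hf⟩ := Module.Finite.exists_fin' R M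
  have : Module.Projective R (Fin n → R) := inferInstance
  exact ⟨of R (Fin n → R), ofHom f, inferInstanceAs (Module.FinitePresentation R (Fin n → R)),
    (IsProjective.iff_projective _).1 this, (epi_iff_surjective _).2 hf⟩

end ModuleCat

theorem corollary4p4 (R : Type u) [Ring R]
    (hR : ModuleCat.leftGlobalDimension R ≠ ⊤) :
    (∀ [IsLeftCoherent R]
        [HasDerivedCategory.{w₁} (ModuleCat.isFinitelyPresented.{u, u} R).FullSubcategory]
        [HasDerivedCategory.{w₂} (ModuleCat.{u} R)],
      (ModuleCat.isFinitelyPresented.{u, u} R).derivedInclusion.IsTriangulated ∧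
      (ModuleCat.isFinitelyPresented.{u, u} R).derivedInclusion.IsEquivalence) ∧
    (∀ [IsNoetherianRing R]
        [HasDerivedCategory.{w₁} (ModuleCat.isFG.{u} R).FullSubcategory]
        [HasDerivedCategory.{w₂} (ModuleCat.{u} R)],
      (ModuleCat.isFG.{u} R).derivedInclusion.IsTriangulated ∧
      (ModuleCat.isFG.{u} R).derivedInclusion.IsEquivalence) := by
  obtain ⟨d, hd⟩ := ModuleCat.exists_hasProjectiveDimensionLT R hR
  refine ⟨fun {_ _ _} ↦ ⟨inferInstance, ?_⟩, fun {_ _ _} ↦ ⟨inferInstance, ?_⟩⟩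
  · refine ObjectProperty.derivedInclusion_isEquivalence (fun M hM ↦ ?_) d fun M _ ↦ hd M
    have : Module.FinitePresentation R M := hM
    exact ModuleCat.exists_epi_of_finite M
  · refine ObjectProperty.derivedInclusion_isEquivalence (fun M hM ↦ ?_) d fun M _ ↦ hd M
    have : Module.Finite R M := hM
    rw [ModuleCat.isFG_eq_isFinitelyPresented]
    exact ModuleCat.exists_epi_of_finite M
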